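/- **Setting.** Time proceeds in steps $t=0,1,2,\dots$. There are $k$ underlay blockchains. The participants are clients, which may go online and offline, and the honest validators of the chains, which are always online and run a client of every chain; all have synchronized clocks. A ledger of an underlay chain is a sequence of blocks, each with an epoch number and a list of items: transactions of the environment, protocol messages, and certified snapshots of ledgers of underlay chains. At each time each online client outputs a finalized ledger of each chain, for which a certificate of finality exists; a snapshot without a certificate is never accepted on a certified ledger. An *overlay protocol* on the $k$ chains interacts with them only by reading and writing: what an honest validator writes to the chains depends only on the underlay ledgers it has seen and the transactions it has been given so far, and the overlay ledger (a sequence of transactions) of a client is a function of the underlay ledgers it has seen so far; the protocol does not make up transactions. *Partial synchrony:* there is a time $\mathrm{GST}$, chosen by the adversary and unknown to the protocol, such that what an honest validator writes to a chain at time $t$ is input to all honest validators of that chain by time $\max(\mathrm{GST},t)+\Delta$, where $\Delta>0$ is known. *Security:* a (underlay or overlay) blockchain is *safe* if any two ledgers output by online clients at any times are consistent (one is a prefix of the other) and the ledger of a client never shrinks. It is *live with latency $\tau$ after $\mathrm{GST}$* if everything (transactions, and for underlay chains all valid items) that has been input to all its honest validators by a time $t$ is in the ledger of every online client at all times $t'\ge\max(\mathrm{GST},t)+\tau$;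 a live underlay chain is understood to have an honest validator, and the honest validators of the overlay are those of all the underlay chains. *Standing assumptions on the underlay chains:* they generate certificates (a safe chain has no certificates for conflicting ledgers), and, whenever live with latency $\tau$, they proceed in epochs of a fixed duration $T>0$ (epoch numbers increase along the ledgers output by clients, a block of epoch $e$ does not appear in them before time $eT$, and by time $\max(\mathrm{GST},eT)+\tau$ every online client sees a block of epoch $e$ or later). Otherwise the adversary determines what unsafe chains show to which client, what non-live chains withhold, and which further items are written. The tuple $(k,s,l)$ is *achievable* if for all $\Delta,T,\tau>0$ there are a constant $\tau'$ and an overlay protocol on $k$ underlay chains such that in every execution a. if at least $s$ underlay chains are safe, then the overlay is safe; b. if at least $l$ underlay chains are live with latency $\tau$ after $\mathrm{GST}$, then the overlay is live with latency $\tau'$ after $\mathrm{GST}$. **Theorem.** Under partial synchrony, for all integers $k\ge 1$, $l$, $s$ with $\lfloor k/2\rfloor+1\le l\le k$ and $s\ge 2(k-l)+1$, the tuple $(k,s,l)$ is achievable. -/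

import Mathlib

/-! ## Ledgers of the underlay chains -/

/-- A block of an underlay chain: the number of the epoch it belongs to and the items it records. -/
structure Block (α : Type) where
  epoch : ℕ
  items : List α

/-- What can be recorded on the ledger of one of the `k` underlay chains: a transaction of the
environment, a message of the overlay protocol, or a certified snapshot of the finalized ledger of
chain `j` (this is how the content of one chain is communicated to another one). -/
inductive Item (k : ℕ) (Tx M : Type) : Type
  | tx (x : Tx)
  | msg (m : M)
  | snap (j : Fin k) (L : List (Block (Item k Tx M)))

/-- A ledger of an underlay chain: a chain of blocks, oldest block first. -/
abbrev Ledger (k : ℕ) (Tx M : Type) : Type := List (Block (Item k Tx M))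

/-- The item `x` is recorded in some block of the ledger `L`. -/
def Recorded {k : ℕ} {Tx M : Type} (x : Item k Tx M) (L : Ledger k Tx M) : Prop :=
  ∃ b ∈ L, x ∈ b.items

/-- The transaction `x` occurs in the ledger `L` of an underlay chain: it is recorded there, or it
occurs in a snapshot which is recorded there. -/
inductive Occurs {k : ℕ} {Tx M : Type} (x : Tx) : Ledger k Tx M → Prop
  | tx {L : Ledger k Tx M} : Recorded (Item.tx x) L → Occurs x L
  | snap {L : Ledger k Tx M} (j : Fin k) (L' : Ledger k Tx M) :
      Recorded (Item.snap j L') L → Occurs x L' → Occurs x L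

/-- Two ledgers are consistent if one of them is a prefix of the other. -/
def Consistent {α : Type} (L L' : List α) : Prop := L <+: L' ∨ L' <+: L

/-- Safety of a family of ledgers `L c t` (the ledger output by client `c` at time `t`, if `c` is
online then): all the ledgers are consistent, and the ledger of a client never shrinks. -/
def SafeLedgers {C α : Type} (online : C → ℕ → Prop) (L : C → ℕ → List α) : Prop :=
  (∀ c c' t t', online c t → online c' t' → Consistent (L c t) (L c' t')) ∧
  (∀ c t t', t ≤ t' → online c t → online c t' → L c t <+: L c t')

/-! ## Overlay protocols -/

/-- What a client has seen up to the time `now`: for every time `t ≤ now` at which it was online,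
the finalized ledgers of the `k` underlay chains in its view (and `none` for all other times). -/
structure History (k : ℕ) (Tx M : Type) where
  now : ℕ
  view : ℕ → Option (Fin k → Ledger k Tx M)

/-- The transaction `x` occurs in one of the underlay ledgers which the client has seen. -/
def History.Seen {k : ℕ} {Tx M : Type} (h : History k Tx M) (x : Tx) : Prop :=
  ∃ t V i, h.view t = some V ∧ Occurs x (V i)

/-- An overlay (interchain) protocol on `k` underlay chains. It interacts with the underlay chains
only by reading their finalized ledgers and by writing items to them.
* `M` is the type of the protocol's own messages;
* `write j h inp i` are the items which an honest validator of chain `j` writes to chain `i`, if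
  its history is `h` and the environment has handed it the transactions `inp t` at time `t`;
* `output h` is the overlay ledger of a client with history `h`.

The protocol does not make up transactions of the environment: those written by a validator have
been handed to it by the environment or occur in the underlay ledgers it has seen, and those in the
overlay ledger of a client occur in the underlay ledgers it has seen.

The protocol does not know the global stabilization time. A smart contract hosted by a chain is a
deterministic function of the ledger of that chain, which `write` and `output` can evaluate. -/
structure Overlay (k : ℕ) (Tx : Type) where
  M : Type
  write : Fin k → History k Tx M → (ℕ → List Tx) → Fin k → List (Item k Tx M)
  output : History k Tx M → List Tx
  write_seen : ∀ j h inp i x, Item.tx x ∈ write j h inp i → (∃ t, x ∈ inp t) ∨ h.Seen x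
  output_seen : ∀ h, ∀ x ∈ output h, h.Seen x

/-! ## Executions -/

/-- The data of an execution with `k` underlay chains. Time proceeds in steps `0, 1, 2, …`. -/
structure Run (k : ℕ) (Tx M : Type) where
  /-- the clients; the honest validators are among them, since they run a client of every chain -/
  Client : Type
  /-- clients go online and offline at will -/
  online : Client → ℕ → Prop
  /-- the honest validators of each chain -/
  validator : Fin k → Set Client
  /-- the global stabilization time -/
  gst : ℕ
  /-- the transactions handed by the environment to a validator of the overlay at a given time -/
  input : Client → ℕ → List Tx
  /-- `recv i v t` are the items which are input to the validator `v` of chain `i` at time `t` -/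
  recv : Fin k → Client → ℕ → Set (Item k Tx M)
  /-- `cert i t` are the ledgers of chain `i` for which the consensus messages broadcast by time
  `t` contain a certificate of finality -/
  cert : Fin k → ℕ → Set (Ledger k Tx M)
  /-- `view c t i` is the finalized ledger of chain `i` output by the client `c` at time `t` -/
  view : Client → ℕ → Fin k → Ledger k Tx M

namespace Run

/-- An item is valid at time `t` if, in case it is a snapshot of the ledger of some chain, a
certificate for that ledger exists by then. -/
def Valid {k : ℕ} {Tx M : Type} (R : Run k Tx M) (t : ℕ) : Item k Tx M → Prop
  | .tx _ => True
  | .msg _ => True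
  | .snap j L => L ∈ R.cert j t

/-- The underlay chain `i` is safe. -/
def SafeChain {k : ℕ} {Tx M : Type} (R : Run k Tx M) (i : Fin k) : Prop :=
  SafeLedgers R.online (fun c t => R.view c t i)

/-- The underlay chain `i` is live with latency `τ` after GST: it has an honest validator, and each
valid item which has been input to all of its honest validators by time `t` is in the ledger of
every client at all times from `max GST t + τ` on. -/
def LiveChain {k : ℕ} {Tx M : Type} (R : Run k Tx M) (τ : ℕ) (i : Fin k) : Prop :=
  (R.validator i).Nonempty ∧
  ∀ (x : Item k Tx M) (t : ℕ), R.Valid t x →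
    (∀ v ∈ R.validator i, ∃ t₀ ≤ t, x ∈ R.recv i v t₀) →
    ∀ c t', R.online c t' → max R.gst t + τ ≤ t' → Recorded x (R.view c t' i)

/-- The underlay chain `i` generates certificates: there are no certificates for conflicting
ledgers. -/
def CertifiedConsistent {k : ℕ} {Tx M : Type} (R : Run k Tx M) (i : Fin k) : Prop :=
  ∀ t t', ∀ L ∈ R.cert i t, ∀ L' ∈ R.cert i t', Consistent L L'

/-- The underlay chain `i` proceeds in epochs of fixed duration `T` and allows clients to track
time: the epoch numbers increase along the ledger, a block of epoch `e` does not appear before the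
time `e * T` at which this epoch begins, and by time `max GST (e * T) + τ` all the clients see a
block of epoch `e` or later. -/
def EpochTimed {k : ℕ} {Tx M : Type} (R : Run k Tx M) (T τ : ℕ) (i : Fin k) : Prop :=
  ∀ c t, R.online c t →
    (R.view c t i).Pairwise (fun b b' => b.epoch < b'.epoch) ∧
    (∀ b ∈ R.view c t i, b.epoch * T ≤ t) ∧
    (∀ e : ℕ, max R.gst (e * T) + τ ≤ t → ∃ b ∈ R.view c t i, e ≤ b.epoch)

open Classical in
/-- What the client `c` has seen up to time `t`. -/
noncomputable def history {k : ℕ} {Tx M : Type} (R : Run k Tx M) (c : R.Client) (t : ℕ) :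
    History k Tx M where
  now := t
  view := fun t' => if t' ≤ t ∧ R.online c t' then some (R.view c t') else none

/-- The transactions which the environment has handed to `c` up to time `t`. -/
def inputs {k : ℕ} {Tx M : Type} (R : Run k Tx M) (c : R.Client) (t : ℕ) : ℕ → List Tx :=
  fun t' => if t' ≤ t then R.input c t' else []

end Run

/-- `R` is an execution of the overlay protocol `P` on certificate-generating underlay chains which
proceed in epochs of duration `T`, in a partially synchronous network with delay bound `Δ`. All
that is not constrained here is up to the adversary: GST, what unsafe chains show to which client,
what stalled chains withhold, and which further items are written to the chains. The number `τ` is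
the latency of the live chains. -/
structure IsExecution {k : ℕ} {Tx : Type} (Δ T τ : ℕ) (P : Overlay k Tx)
    (R : Run k Tx P.M) : Prop where
  /-- honest validators are always online -/
  validator_online : ∀ i, ∀ v ∈ R.validator i, ∀ t, R.online v t
  /-- honest validators follow the protocol, and what one of them writes to chain `i` at time `t`
  is delivered to all honest validators of chain `i` by time `max GST t + Δ` -/
  delivery : ∀ j, ∀ w ∈ R.validator j, ∀ t i, ∀ x ∈ P.write j (R.history w t) (R.inputs w t) i,
    ∀ v ∈ R.validator i, ∃ t' ≤ max R.gst t + Δ, x ∈ R.recv i v t'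
  /-- certificates do not disappear -/
  cert_mono : ∀ i, Monotone (R.cert i)
  /-- clients output certified ledgers only -/
  view_cert : ∀ c t i, R.online c t → R.view c t i ∈ R.cert i t
  /-- certificates of snapshots are verified: a snapshot without a certificate is not accepted -/
  cert_valid : ∀ i t, ∀ L ∈ R.cert i t, ∀ x, Recorded x L → R.Valid t x
  /-- the underlay chains generate certificates -/
  certificates : ∀ i, R.SafeChain i → R.CertifiedConsistent i
  /-- the underlay chains proceed in epochs of fixed duration, whenever they are live -/
  epochs : ∀ i, R.LiveChain τ i → R.EpochTimed T τ i

/-- The overlay protocol `P` is safe in the execution `R`. -/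
def OverlaySafe {k : ℕ} {Tx : Type} (P : Overlay k Tx) (R : Run k Tx P.M) : Prop :=
  SafeLedgers R.online (fun c t => P.output (R.history c t))

/-- The overlay protocol `P` is live with latency `τ` after GST in the execution `R`: each
transaction which has been input to all the honest validators by time `t` is in the overlay ledger
of every client at all times from `max GST t + τ` on. -/
def OverlayLive {k : ℕ} {Tx : Type} (P : Overlay k Tx) (R : Run k Tx P.M) (τ : ℕ) : Prop :=
  ∀ (x : Tx) (t : ℕ), (∀ i, ∀ v ∈ R.validator i, ∃ t₀ ≤ t, x ∈ R.input v t₀) →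
    ∀ c t', R.online c t' → max R.gst t + τ ≤ t' → x ∈ P.output (R.history c t')

/-- The tuple `(k, s, l)` is achievable under partial synchrony: whatever the delay bound `Δ`, the
epoch duration `T` and the latency `τ` of the live underlay chains are, there are a constant `τ'`
and an overlay protocol on `k` underlay chains which, in each of its executions, is safe if at
least `s` underlay chains are safe, and is live with latency `τ'` after GST if at least `l` underlay
chains are live with latency `τ` after GST. -/
def Achievable (k s l : ℕ) : Prop :=
  ∀ Δ T τ : ℕ, 0 < Δ → 0 < T → 0 < τ →
    ∃ τ' : ℕ, ∀ Tx : Type, ∃ P : Overlay k Tx, ∀ R : Run k Tx P.M, IsExecution Δ T τ P R →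
      (s ≤ {i | R.SafeChain i}.ncard → OverlaySafe P R) ∧
      (l ≤ {i | R.LiveChain τ i}.ncard → OverlayLive P R τ')

/-! The overlay is a HotStuff-like consensus protocol in which the underlay chains act as the
replicas. Honest validators only cross-post snapshots and transactions; votes, certificates and
decisions are read off the nested snapshots, with epochs as the clock.

Safety: two quorums of `l` chains together miss at most `2 * (k - l) < s` chains, so they share an
unconflicted one (`exists_mem_of_quorums`). It cannot endorse two proposals in one view
(`QuorumCert.unique`). If it knew the certificate behind a decision, it votes later only for
proposals knowing a certificate at least as recent; by induction along parents these extend the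
decision (`Decided.prefix_of_quorumCert`). Parents are chosen as a function of view and proposal
alone, hence identically by all clients.

Liveness: a client seeing conflicts that leave fewer than `s` chains unconflicted has proof that the
safety premise fails, and may output everything. Otherwise the same counting yields a live chain,
unconflicted in its eyes. Leaders rotate, so this chain soon leads a view after GST; views are long
enough for its proposal to be certified and decided (`IsExecution.exists_decided`). -/

/-! ## Snapshots and prefixes of ledgers -/

section Ledgers

variable {k : ℕ} {Tx M : Type}

/-- A snapshot of the ledger `L` of chain `i` is recorded in the ledger `D`, or in a snapshot
recorded there, and so on. -/
inductive Nested (i : Fin k) (L : Ledger k Tx M) : Ledger k Tx M → Prop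
  | direct {D : Ledger k Tx M} : Recorded (Item.snap i L) D → Nested i L D
  | step {D : Ledger k Tx M} (j : Fin k) (L' : Ledger k Tx M) :
      Recorded (Item.snap j L') D → Nested i L L' → Nested i L D

/-- The ledgers of the chains of which a ledger has nested snapshots. -/
def within (D : Ledger k Tx M) : Fin k → Set (Ledger k Tx M) := fun i => {L | Nested i L D}

/-- A family of sets of ledgers which contains all the snapshots nested in its ledgers. -/
def NestingClosed (W : Fin k → Set (Ledger k Tx M)) : Prop :=
  ∀ i, ∀ L ∈ W i, within L ≤ W

/-- The chains of which the family `W` does not contain conflicting ledgers. -/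
def unconflicted (W : Fin k → Set (Ledger k Tx M)) : Set (Fin k) :=
  {i | ∀ L ∈ W i, ∀ L' ∈ W i, Consistent L L'}

/-- The ledger has reached epoch `e`. -/
def Reaches (e : ℕ) (L : Ledger k Tx M) : Prop := ∃ b ∈ L, e ≤ b.epoch

/-- The part of the ledger before its first block of epoch `e` or later. -/
def before (e : ℕ) (L : Ledger k Tx M) : Ledger k Tx M :=
  L.takeWhile (fun b => decide (b.epoch < e))

/-- The transactions recorded in a ledger (snapshots are not searched). -/
def recordedTxs (L : Ledger k Tx M) : List Tx :=
  L.flatMap fun b => b.items.filterMap fun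
    | .tx x => some x
    | _ => none

theorem mem_recordedTxs {x : Tx} {L : Ledger k Tx M} :
    x ∈ recordedTxs L ↔ Recorded (Item.tx x) L := by
  simp only [recordedTxs, List.mem_flatMap, List.mem_filterMap, Recorded]
  constructor
  · rintro ⟨b, hb, y, hy, h⟩
    cases y with
    | tx z => simp at h; subst h; exact ⟨b, hb, hy⟩
    | msg m => simp at h
    | snap j L => simp at h
  · rintro ⟨b, hb, h⟩
    exact ⟨b, hb, _, h, rfl⟩

theorem Recorded.mono {x : Item k Tx M} {L L' : Ledger k Tx M} (h : L <+: L')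
    (hx : Recorded x L) : Recorded x L' := by
  obtain ⟨b, hb, hxb⟩ := hx
  exact ⟨b, h.subset hb, hxb⟩

theorem Occurs.mono {x : Tx} {L L' : Ledger k Tx M} (h : L <+: L') (hx : Occurs x L) :
    Occurs x L' := by
  cases hx with
  | tx hr => exact .tx (hr.mono h)
  | snap j D hr ho => exact .snap j D (hr.mono h) ho

theorem Nested.mono {i : Fin k} {L D D' : Ledger k Tx M} (h : D <+: D') (hL : Nested i L D) :
    Nested i L D' := by
  cases hL with
  | direct hr => exact .direct (hr.mono h)
  | step j L' hr hn => exact .step j L' (hr.mono h) hn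

theorem within_mono {D D' : Ledger k Tx M} (h : D <+: D') : within D ≤ within D' :=
  fun _ _ hL => Nested.mono h hL

theorem Nested.trans {i j : Fin k} {L L' D : Ledger k Tx M} (h : Nested i L L')
    (h' : Nested j L' D) : Nested i L D := by
  induction h' with
  | direct hr => exact .step j L' hr h
  | step m D' hr _ ih => exact .step m D' hr ih

theorem Occurs.of_nested {x : Tx} {i : Fin k} {L D : Ledger k Tx M} (hx : Occurs x L)
    (h : Nested i L D) : Occurs x D := by
  induction h with
  | direct hr => exact .snap i L hr hx
  | step m D' hr _ ih => exact .snap m D' hr ih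

theorem nestingClosed_within (D : Ledger k Tx M) : NestingClosed (within D) :=
  fun _ _ hL _ _ hL' => Nested.trans hL' hL

/-! ### Cutting ledgers at an epoch. -/

theorem before_prefix (e : ℕ) (L : Ledger k Tx M) : before e L <+: L :=
  List.takeWhile_prefix _

theorem before_eq_self {e : ℕ} {L : Ledger k Tx M} (h : ∀ b ∈ L, b.epoch < e) :
    before e L = L := by
  rw [before, List.takeWhile_eq_self_iff]
  simpa using h

/-- The cut happens inside `L`, so blocks appended later do not move it. -/
theorem before_eq_of_prefix {e : ℕ} {L L' : Ledger k Tx M} (h : L <+: L') (hL : Reaches e L) :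
    before e L' = before e L := by
  obtain ⟨S, rfl⟩ := h
  obtain ⟨b, hb, he⟩ := hL
  simp only [before, List.takeWhile_append]
  rw [if_neg]
  intro h
  have h' := (List.takeWhile_prefix (fun b : Block (Item k Tx M) => decide (b.epoch < e))
    (l := L)).eq_of_length h
  rw [List.takeWhile_eq_self_iff] at h'
  have := h' b hb
  simp at this
  omega

theorem before_mono_ledger (e : ℕ) {L L' : Ledger k Tx M} (h : L <+: L') :
    before e L <+: before e L' := by
  obtain ⟨S, rfl⟩ := h
  simp only [before, List.takeWhile_append]
  split_ifs
  · exact (List.takeWhile_prefix _).trans (List.prefix_append _ _)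
  · exact List.prefix_rfl

theorem before_mono {e e' : ℕ} (h : e ≤ e') (L : Ledger k Tx M) : before e L <+: before e' L := by
  induction L with
  | nil => simp [before]
  | cons b L ih =>
    simp only [before, List.takeWhile_cons] at ih ⊢
    by_cases hb : b.epoch < e
    · simp [hb, hb.trans_le h, List.cons_prefix_cons, ih]
    · simp [hb]

theorem Consistent.before_eq {e : ℕ} {L L' : Ledger k Tx M} (h : Consistent L L')
    (hL : Reaches e L) (hL' : Reaches e L') : before e L = before e L' := by
  rcases h with h | h
  · exact (before_eq_of_prefix h hL).symm
  · exact before_eq_of_prefix h hL'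

/-- Only the ledger with the later cut has to have reached its epoch. This is why a vote requires a
ledger that has reached the start of the view: whatever the chain showed before an earlier epoch is
then accounted for. -/
theorem Consistent.before_prefix_before {e e' : ℕ} {L L' : Ledger k Tx M} (h : Consistent L L')
    (he : e ≤ e') (hL' : Reaches e' L') : before e L <+: before e' L' := by
  rcases h with h | h
  · exact (before_mono_ledger e h).trans (before_mono he L')
  · obtain ⟨b, hb, hbe⟩ := hL'
    rw [before_eq_of_prefix h ⟨b, hb, he.trans hbe⟩]
    exact before_mono he L'

/-- A ledger which has not reached epoch `e` is a prefix of what a consistent ledger which has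
reached it contains before epoch `e`. -/
theorem Consistent.prefix_before {e : ℕ} {L L' : Ledger k Tx M} (h : Consistent L L')
    (hL : ∀ b ∈ L, b.epoch < e) (hL' : Reaches e L') : L <+: before e L' := by
  simpa only [before_eq_self hL] using h.before_prefix_before le_rfl hL'

end Ledgers

/-- Two sets of `l` out of `k` elements and a set of more than `2 * (k - l)` elements meet. -/
theorem exists_mem_of_quorums {k l s : ℕ} (hlk : l ≤ k) (hs : 2 * (k - l) + 1 ≤ s)
    {A B G : Set (Fin k)} (hA : l ≤ A.ncard) (hB : l ≤ B.ncard) (hG : s ≤ G.ncard) :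
    ∃ j, j ∈ A ∧ j ∈ B ∧ j ∈ G := by
  by_contra! h
  have hAc := Set.ncard_add_ncard_compl A
  have hBc := Set.ncard_add_ncard_compl B
  -- Without a common element, `G` is covered by two complements of at most `k - l` elements each.
  have hsub : G ⊆ Aᶜ ∪ Bᶜ := by
    intro j hj
    by_cases hjA : j ∈ A
    · exact Or.inr fun hjB => h j hjA hjB hj
    · exact Or.inl hjA
  have h1 := Set.ncard_le_ncard hsub
  have h2 := Set.ncard_union_le Aᶜ Bᶜ
  simp only [Nat.card_eq_fintype_card, Fintype.card_fin] at hAc hBc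
  omega

/-! ## Votes, quorum certificates and decisions

In view `r`, which begins at epoch `2 * r * N`, the chain `leader r` proposes the part of its ledger
before epoch `(2 * r + 1) * N`. -/

section Consensus

variable {k : ℕ} {Tx M : Type} (l N : ℕ) (leader : ℕ → Fin k)

/-- In the ledger `B`, the only proposal recorded for view `r` is `D`. -/
def Endorses (r : ℕ) (D B : Ledger k Tx M) : Prop :=
  (∃ L, Nested (leader r) L B ∧ Reaches ((2 * r + 1) * N) L ∧ before ((2 * r + 1) * N) L = D) ∧
  ∀ L, Nested (leader r) L B → Reaches ((2 * r + 1) * N) L → before ((2 * r + 1) * N) L = D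

/-- The ledgers in `W` show that `l` chains vote for the proposal `D` in view `r`. A chain votes for
a proposal if it endorses it, and if at the beginning of the view it knew of no certificate of an
earlier view that is more recent than those known in the proposal. -/
def QuorumCert (W : Fin k → Set (Ledger k Tx M)) (r : ℕ) (D : Ledger k Tx M) : Prop :=
  l ≤ {j : Fin k | (∃ B ∈ W j, Endorses N leader r D B) ∧
    ∃ A ∈ W j, Reaches (2 * r * N) A ∧
      ∀ q, ∀ _ : q < r, (∃ E, QuorumCert (within (before (2 * r * N) A)) q E) →
        ∃ q', ∃ _ : q' < r, q ≤ q' ∧ ∃ E, QuorumCert (within D) q' E}.ncard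
termination_by r

/-- The ledgers in `W` show that `l` chains knew of the certificate for the proposal `D` of view `r`
before view `r + 1`. -/
def Decided (W : Fin k → Set (Ledger k Tx M)) (r : ℕ) (D : Ledger k Tx M) : Prop :=
  l ≤ {j : Fin k | ∃ L ∈ W j,
    QuorumCert l N leader (within (before (2 * (r + 1) * N) L)) r D}.ncard

/-- `p` is a certified proposal of the most recent view before `r` for which `D` has one. -/
def IsParent (r : ℕ) (D : Ledger k Tx M) (p : ℕ × Ledger k Tx M) : Prop :=
  p.1 < r ∧ QuorumCert l N leader (within D) p.1 p.2 ∧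
    ∀ q < r, (∃ E, QuorumCert l N leader (within D) q E) → q ≤ p.1

open Classical in
/-- The overlay ledger proposed by `D` in view `r`: it extends that of its parent by the new
transactions recorded in `D`. -/
noncomputable def overlayLedger (r : ℕ) (D : Ledger k Tx M) : List Tx :=
  if h : ∃ p, IsParent l N leader r D p then
    overlayLedger h.choose.1 h.choose.2 ++
      (recordedTxs D).filter (fun x => x ∉ overlayLedger h.choose.1 h.choose.2)
  else recordedTxs D
termination_by r
decreasing_by all_goals exact h.choose_spec.1

variable {l N leader}

/-! ### Monotonicity of evidence, parents, and contents of overlay ledgers. -/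

theorem QuorumCert.mono {W W' : Fin k → Set (Ledger k Tx M)} (h : W ≤ W') {r : ℕ}
    {D : Ledger k Tx M} (hD : QuorumCert l N leader W r D) : QuorumCert l N leader W' r D := by
  rw [QuorumCert] at hD ⊢
  refine hD.trans (Set.ncard_le_ncard ?_)
  rintro j ⟨⟨B, hB, hE⟩, A, hA, hR⟩
  exact ⟨⟨B, h j hB, hE⟩, A, h j hA, hR⟩

theorem Decided.mono {W W' : Fin k → Set (Ledger k Tx M)} (h : W ≤ W') {r : ℕ}
    {D : Ledger k Tx M} (hD : Decided l N leader W r D) : Decided l N leader W' r D := by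
  refine hD.trans (Set.ncard_le_ncard ?_)
  rintro j ⟨L, hL, hq⟩
  exact ⟨L, h j hL, hq⟩

theorem exists_mem_of_le_ncard {S : Set (Fin k)} (hl : 1 ≤ l) (h : l ≤ S.ncard) : ∃ j, j ∈ S :=
  Set.nonempty_of_ncard_ne_zero (by omega)

/-- Any single voter already holds a snapshot of the leader's ledger that begins with the proposal.
Hence whatever is nested in a certified proposal is known wherever its certificate is. -/
theorem QuorumCert.exists_ledger {W : Fin k → Set (Ledger k Tx M)} (hW : NestingClosed W)
    (hl : 1 ≤ l) {r : ℕ} {D : Ledger k Tx M} (h : QuorumCert l N leader W r D) :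
    ∃ L ∈ W (leader r), D <+: L := by
  rw [QuorumCert] at h
  obtain ⟨j, ⟨B, hB, ⟨L, hL, -, rfl⟩, -⟩, -⟩ := exists_mem_of_le_ncard hl h
  exact ⟨L, hW j B hB _ hL, before_prefix _ _⟩

theorem QuorumCert.within_le {W : Fin k → Set (Ledger k Tx M)} (hW : NestingClosed W)
    (hl : 1 ≤ l) {r : ℕ} {D : Ledger k Tx M} (h : QuorumCert l N leader W r D) :
    within D ≤ W := by
  obtain ⟨L, hL, hD⟩ := h.exists_ledger hW hl
  exact (within_mono hD).trans (hW _ L hL)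

theorem Decided.quorumCert {W : Fin k → Set (Ledger k Tx M)} (hW : NestingClosed W)
    (hl : 1 ≤ l) {r : ℕ} {D : Ledger k Tx M} (h : Decided l N leader W r D) :
    QuorumCert l N leader W r D := by
  obtain ⟨j, L, hL, hq⟩ := exists_mem_of_le_ncard hl h
  exact hq.mono ((within_mono (before_prefix _ _)).trans (hW j L hL))

theorem exists_isParent {r q : ℕ} {D E : Ledger k Tx M} (hq : q < r)
    (h : QuorumCert l N leader (within D) q E) : ∃ p, IsParent l N leader r D p := by
  classical
  set S := (Finset.range r).filter fun q => ∃ E, QuorumCert l N leader (within D) q E with hS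
  have hne : S.Nonempty := ⟨q, by
    simp only [hS, Finset.mem_filter, Finset.mem_range]; exact ⟨hq, E, h⟩⟩
  obtain ⟨m, hm, hmax⟩ := S.exists_max_image id hne
  simp only [hS, Finset.mem_filter, Finset.mem_range, id] at hm hmax
  obtain ⟨hmr, E', hE'⟩ := hm
  exact ⟨(m, E'), hmr, hE', fun q' hq' hE => hmax q' ⟨hq', hE⟩⟩

theorem mem_overlayLedger {r : ℕ} {D : Ledger k Tx M} {x : Tx}
    (hx : Recorded (Item.tx x) D) : x ∈ overlayLedger l N leader r D := by
  classical
  rw [← mem_recordedTxs] at hx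
  rw [overlayLedger]
  split_ifs with h
  · simp only [List.mem_append, List.mem_filter, hx, true_and]
    by_cases hx' : x ∈ overlayLedger l N leader h.choose.1 h.choose.2
    · exact Or.inl hx'
    · exact Or.inr (by simpa using hx')
  · exact hx

theorem occurs_of_mem_overlayLedger (hl : 1 ≤ l) {x : Tx} {r : ℕ} {D : Ledger k Tx M}
    (hx : x ∈ overlayLedger l N leader r D) : Occurs x D := by
  induction r using Nat.strong_induction_on generalizing D with
  | _ r ih =>
    rw [overlayLedger] at hx
    split_ifs at hx with h
    · rw [List.mem_append] at hx
      rcases hx with hx | hx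
      · obtain ⟨L, hL, hp⟩ := h.choose_spec.2.1.exists_ledger (nestingClosed_within D) hl
        exact ((ih _ h.choose_spec.1 hx).mono hp).of_nested hL
      · exact .tx (mem_recordedTxs.1 (List.mem_filter.1 hx).1)
    · exact .tx (mem_recordedTxs.1 hx)

/-- There are no conflicting certificates in one view. -/
theorem QuorumCert.unique {s : ℕ} (hlk : l ≤ k) (hs : 2 * (k - l) + 1 ≤ s)
    {W : Fin k → Set (Ledger k Tx M)} (hG : s ≤ (unconflicted W).ncard) {r : ℕ}
    {D D' : Ledger k Tx M} (h : QuorumCert l N leader W r D)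
    (h' : QuorumCert l N leader W r D') : D = D' := by
  rw [QuorumCert] at h h'
  obtain ⟨j, ⟨⟨B, hB, ⟨L, hL, hLr, rfl⟩, hu⟩, -⟩, ⟨⟨B', hB', ⟨L', hL', hLr', rfl⟩, hu'⟩, -⟩, hj⟩ :=
    exists_mem_of_quorums hlk hs h h' hG
  -- The longer of the two ledgers contains both proposals, and it endorses only one.
  rcases hj B hB B' hB' with hp | hp
  · exact hu' L (hL.mono hp) hLr
  · exact (hu L' (hL'.mono hp) hLr').symm

/-- A decision is final: the certified proposals of all later views extend it. -/
theorem Decided.prefix_of_quorumCert {s : ℕ} (hl : 1 ≤ l) (hlk : l ≤ k)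
    (hs : 2 * (k - l) + 1 ≤ s) {W : Fin k → Set (Ledger k Tx M)} (hW : NestingClosed W)
    (hG : s ≤ (unconflicted W).ncard) {r r' : ℕ} (hr : r ≤ r') {D D' : Ledger k Tx M}
    (h : Decided l N leader W r D) (h' : QuorumCert l N leader W r' D') :
    overlayLedger l N leader r D <+: overlayLedger l N leader r' D' := by
  induction r' using Nat.strong_induction_on generalizing D' with
  | _ r' ih =>
    rcases hr.eq_or_lt with rfl | hlt
    · rw [(h.quorumCert hW hl).unique hlk hs hG h']
    · have h'' := h'
      rw [QuorumCert] at h'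
      obtain ⟨j, ⟨L, hL, hq⟩, ⟨-, A, hA, hAr, hlock⟩, hj⟩ := exists_mem_of_quorums hlk hs h h' hG
      -- The common chain held the certificate of view `r` before epoch `2 * (r + 1) * N`, hence
      -- before view `r'` began, so its vote in `r'` is bound by it.
      have hp := (hj L hL A hA).before_prefix_before
        (Nat.mul_le_mul_right N (by omega : 2 * (r + 1) ≤ 2 * r')) hAr
      obtain ⟨q, hqr, hrq, E, hE⟩ := hlock r hlt ⟨D, hq.mono (within_mono hp)⟩
      have hex := exists_isParent hqr hE
      have hspec := hex.choose_spec
      rw [overlayLedger.eq_1 l N leader r' D', dif_pos hex]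
      -- The parent of `D'` has a view in `[r, r')`, and its certificate is available in `W` because
      -- it is nested in `D'`.
      exact (ih _ hspec.1 (hrq.trans (hspec.2.2 q hqr ⟨E, hE⟩))
        (hspec.2.1.mono (h''.within_le hW hl))).trans (List.prefix_append _ _)

end Consensus

/-! ## The overlay protocol -/

section Protocol

variable {k : ℕ} {Tx M : Type}

/-- The ledgers of the chains which a client has seen, including the nested snapshots. -/
def History.knowledge (h : History k Tx M) : Fin k → Set (Ledger k Tx M) :=
  fun i => {L | ∃ t V, h.view t = some V ∧ (L = V i ∨ ∃ j, Nested i L (V j))}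

theorem History.nestingClosed_knowledge (h : History k Tx M) : NestingClosed h.knowledge := by
  rintro i L ⟨t, V, hV, rfl | ⟨j, hj⟩⟩ m L' hL'
  · exact ⟨t, V, hV, Or.inr ⟨i, hL'⟩⟩
  · exact ⟨t, V, hV, Or.inr ⟨j, Nested.trans hL' hj⟩⟩

theorem History.seen_of_mem_knowledge {h : History k Tx M} {i : Fin k} {L : Ledger k Tx M}
    (hL : L ∈ h.knowledge i) {x : Tx} (hx : Occurs x L) : h.Seen x := by
  obtain ⟨t, V, hV, rfl | ⟨j, hj⟩⟩ := hL
  · exact ⟨t, V, i, hV, hx⟩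
  · exact ⟨t, V, j, hV, hx.of_nested hj⟩

/-- `p` is a decision of the most recent view for which the history contains one. -/
def IsLatestDecision (l N : ℕ) (leader : ℕ → Fin k) (h : History k Tx M)
    (p : ℕ × Ledger k Tx M) : Prop :=
  p.1 ≤ h.now ∧ Decided l N leader h.knowledge p.1 p.2 ∧
    ∀ q ≤ h.now, (∃ E, Decided l N leader h.knowledge q E) → q ≤ p.1

/-- The bound by `h.now` leaves finitely many candidate views, so a maximum exists. -/
theorem exists_isLatestDecision {l N : ℕ} {leader : ℕ → Fin k} {h : History k Tx M} {r : ℕ}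
    {D : Ledger k Tx M} (hr : r ≤ h.now) (hD : Decided l N leader h.knowledge r D) :
    ∃ p, IsLatestDecision l N leader h p := by
  classical
  set S := (Finset.range (h.now + 1)).filter fun q => ∃ E, Decided l N leader h.knowledge q E
    with hS
  have hne : S.Nonempty := ⟨r, by
    simp only [hS, Finset.mem_filter, Finset.mem_range]; exact ⟨by omega, D, hD⟩⟩
  obtain ⟨m, hm, hmax⟩ := S.exists_max_image id hne
  simp only [hS, Finset.mem_filter, Finset.mem_range, id] at hm hmax
  obtain ⟨hmr, E, hE⟩ := hm
  exact ⟨(m, E), by omega, hE, fun q' hq' hE => hmax q' ⟨by omega, hE⟩⟩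

/-- The transactions recorded in the current views of a client. -/
def History.currentTxs (h : History k Tx M) : List Tx :=
  match h.view h.now with
  | some V => (List.finRange k).flatMap fun i => recordedTxs (V i)
  | none => []

/-- Snapshots of the ledgers currently output by a client. -/
def History.snapshots (h : History k Tx M) : List (Item k Tx M) :=
  match h.view h.now with
  | some V => (List.finRange k).map fun i => Item.snap i (V i)
  | none => []

open Classical in
/-- The output of the protocol. If a client has evidence that fewer than `s` chains are safe, it
outputs all the transactions it sees. -/
noncomputable def overlayOutput (l s N : ℕ) (leader : ℕ → Fin k) (h : History k Tx M) : List Tx :=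
  if s ≤ (unconflicted h.knowledge).ncard then
    if hd : ∃ p, IsLatestDecision l N leader h p then
      overlayLedger l N leader hd.choose.1 hd.choose.2
    else []
  else h.currentTxs

theorem overlayOutput_seen {l s N : ℕ} {leader : ℕ → Fin k} (hl : 1 ≤ l) {h : History k Tx M}
    {x : Tx} (hx : x ∈ overlayOutput l s N leader h) : h.Seen x := by
  rw [overlayOutput] at hx
  split_ifs at hx with hs hd
  · obtain ⟨L, hL, hp⟩ :=
      (hd.choose_spec.2.1.quorumCert h.nestingClosed_knowledge hl).exists_ledger
        h.nestingClosed_knowledge hl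
    exact History.seen_of_mem_knowledge hL ((occurs_of_mem_overlayLedger hl hx).mono hp)
  · simp at hx
  · rw [History.currentTxs] at hx
    split at hx
    · rename_i V hV
      obtain ⟨i, -, hi⟩ := List.mem_flatMap.1 hx
      exact ⟨_, V, i, hV, .tx (mem_recordedTxs.1 hi)⟩
    · simp at hx

/-- The overlay protocol: honest validators write the transactions of the environment and snapshots
of all the chains to all the chains, at all times. -/
noncomputable def snapshotOverlay (Tx : Type) (l s N : ℕ) (leader : ℕ → Fin k) (hl : 1 ≤ l) :
    Overlay k Tx where
  M := Empty
  write _ h inp _ := h.snapshots ++ ((List.range (h.now + 1)).flatMap inp).map Item.tx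
  output h := overlayOutput l s N leader h
  write_seen := by
    intro j h inp i x hx
    rw [List.mem_append] at hx
    rcases hx with hx | hx
    · rw [History.snapshots] at hx
      split at hx <;> simp at hx
    · simp only [List.mem_map, List.mem_flatMap, Item.tx.injEq, exists_eq_right] at hx
      obtain ⟨t, -, ht⟩ := hx
      exact Or.inl ⟨t, ht⟩
  output_seen _ _ hx := overlayOutput_seen hl hx

/-! ## Safety -/

theorem unconflicted_anti {W W' : Fin k → Set (Ledger k Tx M)} (h : W ≤ W') :
    unconflicted W' ⊆ unconflicted W :=
  fun i hi L hL L' hL' => hi L (h i hL) L' (h i hL')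

namespace Run

theorem history_view {R : Run k Tx M} {c : R.Client} {t u : ℕ} (hu : u ≤ t) (hc : R.online c u) :
    (R.history c t).view u = some (R.view c u) := by
  simp [history, hu, hc]

theorem history_view_eq_some {R : Run k Tx M} {c : R.Client} {t u : ℕ} {V : Fin k → Ledger k Tx M} :
    (R.history c t).view u = some V ↔ (u ≤ t ∧ R.online c u) ∧ R.view c u = V := by
  simp [history]

theorem knowledge_mono (R : Run k Tx M) (c : R.Client) {t t' : ℕ} (h : t ≤ t') :
    (R.history c t).knowledge ≤ (R.history c t').knowledge := by
  rintro i L ⟨u, V, hV, hL⟩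
  rw [history_view_eq_some] at hV
  exact ⟨u, V, history_view_eq_some.2 ⟨⟨hV.1.1.trans h, hV.1.2⟩, hV.2⟩, hL⟩

/-- All the ledgers which are ever certified. -/
def certified (R : Run k Tx M) : Fin k → Set (Ledger k Tx M) := fun i => {L | ∃ t, L ∈ R.cert i t}

end Run

variable {Δ T τ : ℕ} {P : Overlay k Tx} {R : Run k Tx P.M}

theorem IsExecution.nestingClosed_certified (hR : IsExecution Δ T τ P R) :
    NestingClosed R.certified := by
  rintro i L ⟨t, hL⟩ m L' hL'
  refine ⟨t, ?_⟩
  change Nested m L' L at hL'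
  induction hL' generalizing i with
  | direct hr => exact hR.cert_valid i t _ hL _ hr
  | step j D hr _ ih => exact ih j (hR.cert_valid i t _ hL _ hr)

/-- This puts the evidence of all clients at all times into one family, in which safe chains are
unconflicted; decisions of different clients are compared there. -/
theorem IsExecution.knowledge_le_certified (hR : IsExecution Δ T τ P R) (c : R.Client) (t : ℕ) :
    (R.history c t).knowledge ≤ R.certified := by
  rintro i L ⟨u, V, hV, hL⟩
  rw [Run.history_view_eq_some] at hV
  obtain ⟨⟨-, hc⟩, rfl⟩ := hV
  rcases hL with rfl | ⟨j, hj⟩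
  · exact ⟨u, hR.view_cert c u i hc⟩
  · exact hR.nestingClosed_certified j _ ⟨u, hR.view_cert c u j hc⟩ i hj

theorem IsExecution.safeChain_subset (hR : IsExecution Δ T τ P R) :
    {i | R.SafeChain i} ⊆ unconflicted R.certified := by
  rintro i hi L ⟨t, hL⟩ L' ⟨t', hL'⟩
  exact hR.certificates i hi t t' L hL L' hL'

/-- If the history is contained in a family of ledgers in which at least `s` chains are
unconflicted, then the output is the overlay ledger of a latest decision, or empty if there is none. -/
theorem overlayOutput_of_le {l s N : ℕ} {leader : ℕ → Fin k}
    {W : Fin k → Set (Ledger k Tx M)} (hG : s ≤ (unconflicted W).ncard) {h : History k Tx M}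
    (hW : h.knowledge ≤ W) :
    (overlayOutput l s N leader h = [] ∧ ∀ p, ¬ IsLatestDecision l N leader h p) ∨
    ∃ p, IsLatestDecision l N leader h p ∧
      overlayOutput l s N leader h = overlayLedger l N leader p.1 p.2 := by
  rw [overlayOutput, if_pos (hG.trans (Set.ncard_le_ncard (unconflicted_anti hW)))]
  split_ifs with hd
  · exact Or.inr ⟨_, hd.choose_spec, rfl⟩
  · exact Or.inl ⟨rfl, not_exists.1 hd⟩

/-- No client ever reaches the fallback output, since safe chains never show conflicting
certificates. Only consistency and validity of certificates enter, not timing. -/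
theorem IsExecution.overlaySafe {l s N : ℕ} {leader : ℕ → Fin k} (hl : 1 ≤ l) (hlk : l ≤ k)
    (hs : 2 * (k - l) + 1 ≤ s) (hout : ∀ h, P.output h = overlayOutput l s N leader h)
    (hR : IsExecution Δ T τ P R) (hsafe : s ≤ {i | R.SafeChain i}.ncard) :
    OverlaySafe P R := by
  have hG := hsafe.trans (Set.ncard_le_ncard hR.safeChain_subset)
  have hW := hR.nestingClosed_certified
  have key : ∀ c t, _ := fun c t =>
    overlayOutput_of_le (l := l) (N := N) (leader := leader) hG (hR.knowledge_le_certified c t)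
  have hle : ∀ c c' t t' p p', p.1 ≤ p'.1 → IsLatestDecision l N leader (R.history c t) p →
      IsLatestDecision l N leader (R.history c' t') p' →
      overlayLedger l N leader p.1 p.2 <+: overlayLedger l N leader p'.1 p'.2 := by
    intro c c' t t' p p' hpp hp hp'
    exact (hp.2.1.mono (hR.knowledge_le_certified c t)).prefix_of_quorumCert hl hlk hs hW hG hpp
      ((hp'.2.1.mono (hR.knowledge_le_certified c' t')).quorumCert hW hl)
  refine ⟨fun c c' t t' _ _ => ?_, fun c t t' htt _ _ => ?_⟩
  · simp only [hout]
    rcases key c t with ⟨h, -⟩ | ⟨p, hp, h⟩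
    · rw [h]; exact Or.inl List.nil_prefix
    rcases key c' t' with ⟨h', -⟩ | ⟨p', hp', h'⟩
    · rw [h']; exact Or.inr List.nil_prefix
    rw [h, h']
    rcases le_total p.1 p'.1 with hpp | hpp
    · exact Or.inl (hle _ _ _ _ _ _ hpp hp hp')
    · exact Or.inr (hle _ _ _ _ _ _ hpp hp' hp)
  · simp only [hout]
    rcases key c t with ⟨h, -⟩ | ⟨p, hp, h⟩
    · rw [h]; exact List.nil_prefix
    -- Evidence is never lost, so the old decision still counts at `t'` and the latest one is at
    -- least as recent.
    have hD := hp.2.1.mono (R.knowledge_mono c htt)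
    have hnow : p.1 ≤ t' := hp.1.trans htt
    rcases key c t' with ⟨-, h'⟩ | ⟨p', hp', h'⟩
    · obtain ⟨p', hp'⟩ := exists_isLatestDecision (h := R.history c t') hnow hD
      exact absurd hp' (h' p')
    rw [h, h']
    exact hle _ _ _ _ _ _ (hp'.2.2 p.1 hnow ⟨_, hD⟩) hp hp'

end Protocol

/-! ## Liveness -/

section Liveness

variable {k : ℕ} {Tx : Type} {Δ T τ : ℕ} {P : Overlay k Tx} {R : Run k Tx P.M}

/-- What an honest validator writes after GST is recorded on all the live chains within time
`Δ + τ`. -/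
theorem IsExecution.recorded_of_write (hR : IsExecution Δ T τ P R) {i m : Fin k} {w c : R.Client}
    {x : Item k Tx P.M} {u t : ℕ} (hm : R.LiveChain τ m) (hw : w ∈ R.validator i)
    (hx : x ∈ P.write i (R.history w u) (R.inputs w u) m) (hv : R.Valid u x) (hu : R.gst ≤ u)
    (hc : R.online c t) (ht : u + Δ + τ ≤ t) : Recorded x (R.view c t m) := by
  have hmono : R.Valid (u + Δ) x := by
    cases x with
    | tx y => trivial
    | msg y => trivial
    | snap j L => exact hR.cert_mono j (Nat.le_add_right u Δ) hv
  refine hm.2 x (u + Δ) hmono (fun v hvm => ?_) c t hc ?_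
  · obtain ⟨t', ht', hrec⟩ := hR.delivery i w hw u m x hx v hvm
    exact ⟨t', by rwa [max_eq_right hu] at ht', hrec⟩
  · rwa [max_eq_right (by omega)]

theorem Run.mem_knowledge_of_recorded {c : R.Client} {t : ℕ} (hc : R.online c t) {i j : Fin k}
    {L : Ledger k Tx P.M} (h : Recorded (Item.snap i L) (R.view c t j)) :
    L ∈ (R.history c t).knowledge i :=
  ⟨t, _, Run.history_view le_rfl hc, Or.inr ⟨j, .direct h⟩⟩

/-- In a view after GST whose leader is live, the proposal of the leader is decided, if the client
has no evidence that the leader is not safe. -/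
theorem IsExecution.exists_decided {l N r t : ℕ} {leader : ℕ → Fin k} (hR : IsExecution Δ T τ P R)
    (hT : 0 < T) (hN : 3 * τ + 2 * Δ < N)
    (hlive : l ≤ {i | R.LiveChain τ i}.ncard) (hleader : R.LiveChain τ (leader r))
    (hgst : R.gst ≤ 2 * r * N * T) {c w : R.Client} (hw : ∀ u, R.online w u)
    (hsnap : ∀ c' u u' i m, R.gst ≤ u → R.online c' u' → u + Δ + τ ≤ u' → R.LiveChain τ m →
      Recorded (Item.snap i (R.view w u i)) (R.view c' u' m))
    (hc : R.online c t) (ht : (2 * r + 1) * N * T + 4 * τ + 3 * Δ ≤ t)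
    (huc : leader r ∈ unconflicted (R.history c t).knowledge) {x : Tx}
    (hx : ∀ u, 2 * r * N * T + Δ + τ ≤ u → Recorded (Item.tx x) (R.view w u (leader r))) :
    ∃ D, Decided l N leader (R.history c t).knowledge r D ∧ Recorded (Item.tx x) D := by
  have hNT : N ≤ N * T := Nat.le_mul_of_pos_right N hT
  have hb : (2 * r + 1) * N * T = 2 * r * N * T + N * T := by ring
  have hb' : 2 * (r + 1) * N * T = 2 * r * N * T + N * T + N * T := by ring
  set a := 2 * r * N * T with ha
  set b := (2 * r + 1) * N * T with hbdef
  set W := (R.history c t).knowledge with hWdef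
  have hW : NestingClosed W := History.nestingClosed_knowledge _
  -- The client learns the views of `w` through snapshots on the leader's chain.
  have hmem : ∀ u i, R.gst ≤ u → u + Δ + τ ≤ t → R.view w u i ∈ W i := fun u i hu hut =>
    Run.mem_knowledge_of_recorded hc (hsnap c u t i (leader r) hu hc hut hleader)
  have hreach : ∀ e u j, R.LiveChain τ j → R.gst ≤ e * T → e * T + τ ≤ u →
      Reaches e (R.view w u j) := fun e u j hj he hu =>
    (hR.epochs j hj w u (hw u)).2.2 e (by rwa [max_eq_right he])
  have hearly : ∀ e u j, R.LiveChain τ j → u < e * T → ∀ β ∈ R.view w u j, β.epoch < e :=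
    fun e u j hj hu β hβ => Nat.lt_of_mul_lt_mul_right
      (lt_of_le_of_lt ((hR.epochs j hj w u (hw u)).2.1 β hβ) hu)
  -- the ledger of the leader reaches the epoch of the proposal
  have hLr : Reaches ((2 * r + 1) * N) (R.view w (b + τ) (leader r)) :=
    hreach _ _ _ hleader (by omega) (by omega)
  have hLW : R.view w (b + τ) (leader r) ∈ W (leader r) := hmem _ _ (by omega) (by omega)
  set D := before ((2 * r + 1) * N) (R.view w (b + τ) (leader r)) with hD
  -- At time `a + 2τ + Δ < b` the leader has no block of epoch `(2 * r + 1) * N` yet, so all it has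
  -- recorded by then enters the proposal.
  have hLD : R.view w (a + τ + Δ + τ) (leader r) <+: D :=
    (huc _ (hmem _ _ (by omega) (by omega)) _ hLW).prefix_before
      (hearly _ _ _ hleader (by omega)) hLr
  -- Uniqueness comes from the leader being unconflicted: every snapshot of it that has reached the
  -- cut gives the same `D`.
  have hendorse : ∀ j, R.LiveChain τ j →
      Endorses N leader r D (R.view w (b + τ + Δ + τ) j) := by
    intro j hj
    refine ⟨⟨_, .direct (hsnap w (b + τ) _ (leader r) j (by omega) (hw _) le_rfl hj), hLr, rfl⟩,
      fun L hL hLreach => ?_⟩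
    exact (huc _ (hW j _ (hmem _ _ (by omega) (by omega)) _ hL) _ hLW).before_eq hLreach hLr
  have hcert : ∀ m, R.LiveChain τ m →
      QuorumCert l N leader (within (R.view w (b + τ + Δ + τ + Δ + τ) m)) r D := by
    intro m hm
    rw [QuorumCert]
    refine hlive.trans (Set.ncard_le_ncard fun j hj => ?_)
    refine ⟨⟨_, .direct (hsnap w (b + τ + Δ + τ) _ j m (by omega) (hw _) le_rfl hm), hendorse j hj⟩,
      R.view w (a + τ) j, .direct (hsnap w (a + τ) _ j m (by omega) (hw _) (by omega) hm),
      hreach _ _ _ hj hgst le_rfl, ?_⟩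
    rintro q hq ⟨E, hE⟩
    -- The view-start ledger of `j` was snapshotted on the leader's chain in time to be nested in
    -- `D`, so `D` knows the very same certificate.
    refine ⟨q, hq, le_rfl, E, hE.mono ((within_mono (before_prefix _ _)).trans ?_)⟩
    refine nestingClosed_within D j _ (Nested.mono hLD (.direct ?_))
    exact hsnap w (a + τ) _ j (leader r) (by omega) (hw _) le_rfl hleader
  refine ⟨D, hlive.trans (Set.ncard_le_ncard fun m hm => ?_),
    (hx _ (by omega)).mono hLD⟩
  refine ⟨R.view w (b + τ + Δ + τ + Δ + τ) m, hmem _ _ (by omega) (by omega), ?_⟩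
  -- Here `3 * τ + 2 * Δ < N` is needed: the certificates are on the live chains at `b + 3τ + 2Δ`,
  -- before view `r + 1` can begin.
  rw [before_eq_self (hearly _ _ _ hm (by omega))]
  exact hcert m hm

theorem Run.snap_mem_snapshots {w : R.Client} {u : ℕ} (hw : R.online w u) (i : Fin k) :
    Item.snap i (R.view w u i) ∈ (R.history w u).snapshots := by
  have h : (R.history w u).view (R.history w u).now = some (R.view w u) :=
    Run.history_view le_rfl hw
  simp only [History.snapshots, h, List.mem_map]
  exact ⟨i, List.mem_finRange i, rfl⟩

theorem Run.mem_currentTxs {c : R.Client} {t : ℕ} (hc : R.online c t) {i : Fin k} {x : Tx}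
    (hx : Recorded (Item.tx x) (R.view c t i)) : x ∈ (R.history c t).currentTxs := by
  have h : (R.history c t).view (R.history c t).now = some (R.view c t) :=
    Run.history_view le_rfl hc
  simp only [History.currentTxs, h, List.mem_flatMap]
  exact ⟨i, List.mem_finRange i, mem_recordedTxs.2 hx⟩

/-- One honest validator `w` of one live chain suffices as the source of all snapshots and
transactions used. The number of safe chains is not assumed; the client's own evidence decides
between the two cases. -/
theorem IsExecution.overlayLive {l s N : ℕ} {leader : ℕ → Fin k} (hl : 1 ≤ l) (hlk : l ≤ k)
    (hs : 2 * (k - l) + 1 ≤ s) (hT : 0 < T) (hN : 3 * τ + 2 * Δ < N)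
    (hleader : ∀ i r, ∃ q, r ≤ q ∧ q < r + k ∧ leader q = i)
    (hwrite : ∀ j h inp i, P.write j h inp i =
      h.snapshots ++ ((List.range (h.now + 1)).flatMap inp).map Item.tx)
    (hout : ∀ h, P.output h = overlayOutput l s N leader h)
    (hR : IsExecution Δ T τ P R) (hlive : l ≤ {i | R.LiveChain τ i}.ncard) :
    OverlayLive P R ((2 * k + 3) * N * T + 4 * τ + 3 * Δ) := by
  intro x t hx c t' hc ht'
  obtain ⟨i₀, hi₀⟩ := exists_mem_of_le_ncard hl hlive
  obtain ⟨w, hwv⟩ := hi₀.1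
  have hw : ∀ u, R.online w u := hR.validator_online i₀ w hwv
  have hsnap : ∀ c' u u' i m, R.gst ≤ u → R.online c' u' → u + Δ + τ ≤ u' → R.LiveChain τ m →
      Recorded (Item.snap i (R.view w u i)) (R.view c' u' m) := by
    intro c' u u' i m hu hc' huu hm
    refine hR.recorded_of_write hm hwv ?_ (hR.view_cert w u i (hw u)) hu hc' huu
    rw [hwrite]
    exact List.mem_append_left _ (Run.snap_mem_snapshots (hw u) i)
  have htx : ∀ c' u' m, R.online c' u' → max R.gst t + Δ + τ ≤ u' → R.LiveChain τ m →
      Recorded (Item.tx x) (R.view c' u' m) := by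
    intro c' u' m hc' huu hm
    -- All past inputs are rewritten at every step, so the write at a time after GST can be used.
    refine hR.recorded_of_write hm hwv (u := max R.gst t) ?_ trivial (le_max_left _ _) hc' huu
    rw [hwrite]
    obtain ⟨t₀, ht₀, hxt⟩ := hx i₀ w hwv
    have ht₁ : t₀ ≤ max R.gst t := ht₀.trans (le_max_right _ _)
    refine List.mem_append_right _ (List.mem_map_of_mem (List.mem_flatMap.2 ⟨t₀, ?_, ?_⟩))
    · exact List.mem_range.2 (Nat.lt_succ_of_le ht₁)
    · simpa [Run.inputs, ht₁] using hxt
  rw [hout]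
  by_cases hG : s ≤ (unconflicted (R.history c t').knowledge).ncard
  · obtain ⟨i, hi, -, hiG⟩ := exists_mem_of_quorums hlk hs hlive hlive hG
    set t₀ := max R.gst t with ht₀
    have hNT : 0 < 2 * N * T := Nat.mul_pos (by omega) hT
    obtain ⟨r, hr, hrk, rfl⟩ := hleader i (t₀ / (2 * N * T) + 1)
    have h1 : t₀ ≤ 2 * r * N * T := by
      have := Nat.lt_mul_of_div_lt (Nat.lt_of_succ_le hr) hNT
      nlinarith
    have h2 : (2 * r + 1) * N * T ≤ t₀ + (2 * k + 3) * N * T := by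
      have h3 := Nat.div_mul_le_self t₀ (2 * N * T)
      have h4 : r * (2 * N * T) ≤ (t₀ / (2 * N * T) + k + 1) * (2 * N * T) :=
        Nat.mul_le_mul_right _ (by omega)
      nlinarith
    obtain ⟨D, hD, hxD⟩ := hR.exists_decided hT hN hlive hi ((le_max_left _ _).trans h1) hw hsnap hc
      (by omega) hiG (x := x) (fun u hu => htx w u _ (hw u) (by omega) hi)
    have hrt : r ≤ (R.history c t').now := by
      change r ≤ t'
      have : r * 1 ≤ r * (2 * N * T) := Nat.mul_le_mul_left r hNT
      have h5 : r * (2 * N * T) ≤ (2 * r + 1) * N * T := by nlinarith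
      omega
    rcases overlayOutput_of_le (l := l) (N := N) (leader := leader) hG le_rfl with
      ⟨-, h⟩ | ⟨p, hp, h⟩
    · obtain ⟨p, hp⟩ := exists_isLatestDecision hrt hD
      exact absurd hp (h p)
    · rw [h]
      have hW := (R.history c t').nestingClosed_knowledge
      -- The finality lemma, applied inside the client's own knowledge: the latest decision extends
      -- the one containing `x`.
      exact (hD.prefix_of_quorumCert hl hlk hs hW hG (hp.2.2 r hrt ⟨D, hD⟩)
        (hp.2.1.quorumCert hW hl)).subset (mem_overlayLedger hxD)
  · rw [overlayOutput, if_neg hG]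
    -- In the fallback case `x` is read directly from a live chain.
    exact Run.mem_currentTxs hc (htx c t' i₀ hc (by omega) hi₀)

end Liveness

/-! ### Round-robin leaders and choice of the view length. -/

theorem theorem1 (k s l : ℕ) (hk : 1 ≤ k) (hl : k / 2 + 1 ≤ l) (hlk : l ≤ k)
    (hs : 2 * (k - l) + 1 ≤ s) : Achievable k s l := by
  intro Δ T τ _ hT _
  have hl1 : 1 ≤ l := by omega
  let leader : ℕ → Fin k := fun r => ⟨r % k, Nat.mod_lt r hk⟩
  have hleader : ∀ i r, ∃ q, r ≤ q ∧ q < r + k ∧ leader q = i := by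
    intro i r
    have hmem : (i : ℕ) ∈ (Finset.Ico r (r + k)).image (· % k) := by
      rw [Nat.image_Ico_mod]
      exact Finset.mem_range.2 i.2
    obtain ⟨q, hq, hqi⟩ := Finset.mem_image.1 hmem
    exact ⟨q, (Finset.mem_Ico.1 hq).1, (Finset.mem_Ico.1 hq).2, Fin.ext hqi⟩
  -- `N = 3 * τ + 2 * Δ + 1` is the least half-view length, in epochs, that satisfies `3 * τ + 2 * Δ
  -- < N`.
  refine ⟨(2 * k + 3) * (3 * τ + 2 * Δ + 1) * T + 4 * τ + 3 * Δ, fun Tx =>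
    ⟨snapshotOverlay Tx l s (3 * τ + 2 * Δ + 1) leader hl1, fun R hR => ⟨?_, ?_⟩⟩⟩
  · exact hR.overlaySafe hl1 hlk hs fun _ => rfl
  · exact hR.overlayLive hl1 hlk hs hT (Nat.lt_succ_self _) hleader (fun _ _ _ _ => rfl) fun _ => rfl
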